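/- A re-pairing of a well-formed (Dyck) word $\sigma=\sigma(1)\cdots\sigma(N)$ over the brackets $+$ (opening) and $-$ (closing) is a sequence of pairs $p=((\ell_1,r_1),\dots,(\ell_{N/2},r_{N/2}))$ of positions such that $\sigma(\ell_i)=+$, $\sigma(r_i)=-$ and $\ell_i<r_i$ for all $i$, and every position in $\{1,\dots,N\}$ occurs in exactly one pair. Let $B_t(p)$ be the set of positions occurring in the first $t$ pairs. The width of a finite set of integers is the smallest number of integer intervals whose union is that set; the width of $p$ is the maximum over $0\le t\le N/2$ of the width of $B_t(p)$; and $\operatorname{width}(\sigma)$ is the minimum of the widths of the re-pairings of $\sigma$. Let $Z(n)$, $n\ge 1$, be the words associated with the complete binary trees of height $n-1$, that is, $Z(1)={+}{-}$ and $Z(n+1)={+}Z(n)Z(n){-}$, and let $|Z(n)|$ be the length of $Z(n)$. Then, as $n\to\infty$, $$\operatorname{width}(Z(n))=\Omega\!\left(\frac{\log n}{\log\log n}\right)\quad\text{and}\quad \operatorname{width}(Z(n))=\Omega\!\left(\frac{\log\log|Z(n)|}{\log\log\log|Z(n)|}\right),$$ and these two bounds are of the same order: $$\frac{\log n}{\log\log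 n}=\Theta\!\left(\frac{\log\log|Z(n)|}{\log\log\log|Z(n)|}\right).$$ -/

import Mathlib

open Filter Asymptotics

/-! Re-pairings of Dyck words and their width. Dyck words are Mathlib's `DyckWord`: lists of
`DyckStep.U` (an opening bracket, `+`) and `DyckStep.D` (a closing bracket, `-`). -/

namespace RePairing

/-- The smallest number of integer intervals `[a, b]` whose union is the finite set `S`. -/
noncomputable def intervalWidth (S : Finset ℤ) : ℕ :=
  sInf {k : ℕ | ∃ a b : Fin k → ℤ, (S : Set ℤ) = ⋃ i, Set.Icc (a i) (b i)}

/-- A re-pairing of a Dyck word `w` of length `N`: a sequence of `N / 2` pairs of positions such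
that each pair consists of an opening bracket and a closing bracket to its right, and every
position of `w` occurs in exactly one pair. Positions are counted from `0`. -/
structure Repairing (w : DyckWord) where
  left : Fin (w.toList.length / 2) → Fin w.toList.length
  right : Fin (w.toList.length / 2) → Fin w.toList.length
  left_open : ∀ i, w.toList.get (left i) = DyckStep.U
  right_close : ∀ i, w.toList.get (right i) = DyckStep.D
  left_lt_right : ∀ i, left i < right i
  exactly_one : ∀ b, ∃! i, b = left i ∨ b = right i

/-- The set of positions erased by the first `t` pairs. -/
def Repairing.erased {w : DyckWord} (p : Repairing w) (t : ℕ) : Finset ℤ :=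
  (Finset.univ.filter fun i : Fin (w.toList.length / 2) => (i : ℕ) < t).biUnion
    fun i => {((p.left i : ℕ) : ℤ), ((p.right i : ℕ) : ℤ)}

/-- The width of a re-pairing: the maximum over the times `t = 0, 1, …, N / 2` of the width of
the set of positions erased up to time `t`. -/
noncomputable def Repairing.width {w : DyckWord} (p : Repairing w) : ℕ :=
  (Finset.range (w.toList.length / 2 + 1)).sup fun t => intervalWidth (p.erased t)

/-- The width of a Dyck word: the minimum width of a re-pairing of it. -/
noncomputable def width (w : DyckWord) : ℕ :=
  sInf (Set.range fun p : Repairing w => p.width)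

/-- The word `Z(n)` of the complete binary tree of height `n - 1`: `Z(1) = +-` and
`Z(n+1) = + Z(n) Z(n) -`. The value at `0` is the empty word, so that one recursion covers both
clauses. -/
def Z : ℕ → DyckWord
  | 0 => 0
  | n + 1 => (Z n + Z n).nest

theorem Z_one : (Z 1).toList = [DyckStep.U, DyckStep.D] := rfl

theorem Z_succ (n : ℕ) :
    (Z (n + 1)).toList = [DyckStep.U] ++ ((Z n).toList ++ (Z n).toList) ++ [DyckStep.D] := rfl

end RePairing

/-! View positions as cuts between letters. The number `bal t p` of pairs among the first `t` that
straddle the cut `p` grows with `t`, lies between 0 and the height at `p`, follows the height along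
erased runs and is constant along surviving ones. A set of width `W` has at most `K = 2W` boundaries
between erased and surviving letters (`card_boundary_le`).

The core is an induction on `j` (`exists_boundaries`): every copy of `Z m_j` in `Z n`, with `m_j =
(K+4)^j (s+2)` and `n + 4 ≤ 2^s`, has at least `j+1` boundaries at some moment. Suppose a copy of `Z
m_{j+1}` never has more than `j+1`. It contains `2^{m_j}` disjoint, deeply nested copies of `Z m_j`,
each of which, at some moment, holds all the boundaries of the big copy; at that moment everything
to its left in the big copy has one status and everything to its right has one status. So erasure
sweeps across the big copy in one direction. Between consecutive moments the balance at one end of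
the big copy must change by at least 1, because the nested copies lie far above the valleys between
them while few boundaries allow only a small change across a nested copy. That balance stays between
0 and the height `D` of the end, so there are at most `D + 3` nested copies (`Play.sweep`), fewer
than `2^{m_j}`.

Taking `j = K` forces `n < (K+4)^K (s+2)` with `s` free (`lt_of_width`), and logarithms give the
bound. -/

namespace RePairing

/-! ### Erasure orders, their boundaries, and the sweep argument. -/

/-- The order of erasure along a word with height function `h`: position `p` disappears in move
`time p`, and `bal t p` is the balance of the erased brackets before `p` after `t` moves. -/
structure Play (h : ℕ → ℤ) (N : ℕ) where
  time : ℕ → ℕ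
  bal : ℕ → ℕ → ℤ
  bal_mono : ∀ p s t, s ≤ t → bal s p ≤ bal t p
  bal_nonneg : ∀ t p, 0 ≤ bal t p
  bal_le : ∀ t p, p ≤ N → bal t p ≤ h p
  bal_succ_of_lt : ∀ t p, p < N → time p < t → bal t (p + 1) - bal t p = h (p + 1) - h p
  bal_succ_of_le : ∀ t p, p < N → t ≤ time p → bal t (p + 1) = bal t p
  not_three : ∀ p q r, p < q → q < r → r < N → ¬(time p = time q ∧ time q = time r)

/-- The points strictly between `a` and `b` at which exactly one of the two neighbouring positions
has been erased by the first `t` moves. -/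
def boundaries (τ : ℕ → ℕ) (t a b : ℕ) : Finset ℕ :=
  (Finset.Ioo a b).filter fun p => ¬(τ (p - 1) < t ↔ τ p < t)

theorem mem_boundaries {τ : ℕ → ℕ} {t a b p : ℕ} :
    p ∈ boundaries τ t a b ↔ (a < p ∧ p < b) ∧ ¬(τ (p - 1) < t ↔ τ p < t) := by
  simp [boundaries]

theorem boundaries_subset {τ : ℕ → ℕ} {t a b a' b' : ℕ} (ha : a ≤ a') (hb : b' ≤ b) :
    boundaries τ t a' b' ⊆ boundaries τ t a b := by
  intro p hp
  rw [mem_boundaries] at hp ⊢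
  exact ⟨⟨by omega, by omega⟩, hp.2⟩

theorem lt_iff_of_no_boundary {τ : ℕ → ℕ} {t a : ℕ} (c : ℕ) (hac : a ≤ c)
    (H : ∀ p, a < p → p ≤ c → (τ (p - 1) < t ↔ τ p < t)) : τ c < t ↔ τ a < t := by
  induction c, hac using Nat.le_induction with
  | base => rfl
  | succ c hc ih =>
    rw [← ih fun p h1 h2 => H p h1 (by omega)]
    simpa using (H (c + 1) (by omega) le_rfl).symm

theorem boundaries_nonempty {τ : ℕ → ℕ} {t a b p q : ℕ} (hp : a ≤ p) (hpq : p < q) (hq : q < b)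
    (H : ¬(τ p < t ↔ τ q < t)) : (boundaries τ t a b).Nonempty := by
  by_contra hne
  rw [Finset.not_nonempty_iff_eq_empty] at hne
  refine H (lt_iff_of_no_boundary q hpq.le fun r h1 h2 => ?_).symm
  by_contra hr
  have : r ∈ boundaries τ t a b := mem_boundaries.2 ⟨⟨by omega, by omega⟩, hr⟩
  simp [hne] at this

theorem exists_of_boundaries_nonempty {τ : ℕ → ℕ} {t a b : ℕ}
    (H : (boundaries τ t a b).Nonempty) :
    (∃ p, a ≤ p ∧ p < b ∧ τ p < t) ∧ ∃ p, a ≤ p ∧ p < b ∧ t ≤ τ p := by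
  obtain ⟨p, hp⟩ := H
  rw [mem_boundaries] at hp
  obtain ⟨⟨h1, h2⟩, h3⟩ := hp
  by_cases h4 : τ p < t
  · exact ⟨⟨p, by omega, by omega, h4⟩, p - 1, by omega, by omega, by
      by_contra h5; exact h3 ⟨fun _ => h4, fun _ => by omega⟩⟩
  · exact ⟨⟨p - 1, by omega, by omega, by
      by_contra h5; exact h3 ⟨fun h => absurd h h5, fun h => absurd h h4⟩⟩, p, by omega, by omega,
      by omega⟩

namespace Play

variable {h : ℕ → ℤ} {N : ℕ} (P : Play h N)
include P

theorem bal_sub_of_erased {t a b : ℕ} (hab : a ≤ b) (hb : b ≤ N)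
    (H : ∀ q, a ≤ q → q < b → P.time q < t) : P.bal t b - P.bal t a = h b - h a := by
  induction b, hab using Nat.le_induction with
  | base => simp
  | succ c hc ih =>
    have h1 := ih (by omega) fun q h1 h2 => H q h1 (by omega)
    have h2 := P.bal_succ_of_lt t c (by omega) (H c hc (by omega))
    linarith

theorem bal_eq_of_not_erased {t a b : ℕ} (hab : a ≤ b) (hb : b ≤ N)
    (H : ∀ q, a ≤ q → q < b → t ≤ P.time q) : P.bal t b = P.bal t a := by
  induction b, hab using Nat.le_induction with
  | base => simp
  | succ c hc ih =>
    rw [P.bal_succ_of_le t c (by omega) (H c hc (by omega)),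
      ih (by omega) fun q h1 h2 => H q h1 (by omega)]

/-- The `c` boundaries cut the factor into `c + 1` runs of constant status. Across a surviving run
the balance does not move; across an erased run it moves with the height, hence by at most `m`. -/
theorem abs_bal_sub_le {t : ℕ} {E m : ℤ} (c : ℕ) : ∀ {a b : ℕ}, a ≤ b → b ≤ N →
    (∀ q, a ≤ q → q ≤ b → E ≤ h q ∧ h q ≤ E + m) → (boundaries P.time t a b).card = c →
    |P.bal t b - P.bal t a| ≤ (c + 1) * m := by
  induction c using Nat.strong_induction_on with
  | _ c ih =>
    intro a b hab hb hh hc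
    have hm : 0 ≤ m := by linarith [(hh a le_rfl hab).1, (hh a le_rfl hab).2]
    rcases (boundaries P.time t a b).eq_empty_or_nonempty with he | ⟨p, hp⟩
    · have key : ∀ q, a ≤ q → q < b → (P.time q < t ↔ P.time a < t) := by
        intro q h1 h2
        refine lt_iff_of_no_boundary q h1 fun r h3 h4 => ?_
        by_contra hr
        have : r ∈ boundaries P.time t a b := mem_boundaries.2 ⟨⟨by omega, by omega⟩, hr⟩
        simp [he] at this
      have h0 := hh a le_rfl hab
      have h1 := hh b hab le_rfl
      have h2 : |P.bal t b - P.bal t a| ≤ m := by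
        by_cases hat : P.time a < t
        · rw [P.bal_sub_of_erased hab hb fun q h1 h2 => (key q h1 h2).2 hat, abs_le]
          constructor <;> linarith
        · rw [P.bal_eq_of_not_erased hab hb fun q h1 h2 => not_lt.1 fun h3 =>
            hat ((key q h1 h2).1 h3)]
          simpa using hm
      have : (0 : ℤ) ≤ c * m := by positivity
      linarith
    · obtain ⟨⟨h1, h2⟩, h3⟩ := mem_boundaries.1 hp
      -- Split at one boundary `p`, which belongs to neither open half, so the counts add up to `c -
      -- 1`.
      have hu : boundaries P.time t a b =
          insert p (boundaries P.time t a p ∪ boundaries P.time t p b) := by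
        ext q
        simp only [Finset.mem_insert, Finset.mem_union, mem_boundaries]
        constructor
        · rintro ⟨⟨h4, h5⟩, h6⟩
          rcases lt_trichotomy q p with h7 | h7 | h7
          · exact Or.inr (Or.inl ⟨⟨h4, h7⟩, h6⟩)
          · exact Or.inl h7
          · exact Or.inr (Or.inr ⟨⟨h7, h5⟩, h6⟩)
        · rintro (rfl | ⟨⟨h4, h5⟩, h6⟩ | ⟨⟨h4, h5⟩, h6⟩)
          · exact ⟨⟨h1, h2⟩, h3⟩
          · exact ⟨⟨h4, by omega⟩, h6⟩
          · exact ⟨⟨by omega, h5⟩, h6⟩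
      have hcard : c = (boundaries P.time t a p).card + (boundaries P.time t p b).card + 1 := by
        rw [← hc, hu, Finset.card_insert_of_notMem, Finset.card_union_of_disjoint]
        · rw [Finset.disjoint_left]
          intro q hq hq'
          rw [mem_boundaries] at hq hq'
          omega
        · simp [mem_boundaries]
      have i1 := ih (boundaries P.time t a p).card (by omega) h1.le (by omega)
        (fun q h4 h5 => hh q h4 (by omega)) rfl
      have i2 := ih (boundaries P.time t p b).card (by omega) h2.le (by omega)
        (fun q h4 h5 => hh q (by omega) h5) rfl
      have i3 : |P.bal t b - P.bal t a| ≤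
          |P.bal t b - P.bal t p| + |P.bal t p - P.bal t a| := abs_sub_le _ _ _
      rw [hcard]
      push_cast
      linarith

/-- If a subfactor has as many boundaries as the factor, the rest of the factor has none. -/
theorem strips {t a b a' b' J : ℕ} (ha : a ≤ a') (hab : a' < b') (hb : b' ≤ b)
    (hle : (boundaries P.time t a b).card ≤ J) (hge : J ≤ (boundaries P.time t a' b').card) :
    (∀ q, a ≤ q → q ≤ a' → (P.time q < t ↔ P.time a < t)) ∧
    ∀ q, b' ≤ q + 1 → q < b → (P.time q < t ↔ P.time (b - 1) < t) := by
  have heq : boundaries P.time t a' b' = boundaries P.time t a b :=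
    Finset.eq_of_subset_of_card_le (boundaries_subset ha hb) (hle.trans hge)
  have key : ∀ p, a < p → p < b → (p ≤ a' ∨ b' ≤ p) → (P.time (p - 1) < t ↔ P.time p < t) := by
    intro p h1 h2 h3
    by_contra h4
    have : p ∈ boundaries P.time t a' b' := heq ▸ mem_boundaries.2 ⟨⟨h1, h2⟩, h4⟩
    rw [mem_boundaries] at this
    omega
  refine ⟨fun q h1 h2 => lt_iff_of_no_boundary q h1 fun p h3 h4 =>
    key p h3 (by omega) (Or.inl (by omega)), fun q h1 h2 => ?_⟩
  exact (lt_iff_of_no_boundary (b - 1) (by omega) fun p h3 h4 =>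
    key p (by omega) (by omega) (Or.inr (by omega))).symm

/-- If each of `Q` consecutive deep subfactors of a factor carries, at some time, all the
boundaries that the factor can have, then `Q` is at most the height of the factor plus `3`. -/
theorem sweep {a b J Q : ℕ} {D E E' m : ℤ} (p α γ T : ℕ → ℕ) (hbN : b ≤ N)
    (ha : h a = D) (hb : h b = D)
    (hpos : ∀ l < Q, a ≤ p l ∧ p l ≤ α l ∧ α l < γ l ∧ γ l ≤ b)
    (hsucc : ∀ l, l + 1 < Q → γ l ≤ p (l + 1))
    (hα : ∀ l < Q, h (α l) = E) (hγ : ∀ l < Q, h (γ l) = E)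
    (hin : ∀ l < Q, ∀ q, α l ≤ q → q ≤ γ l → E ≤ h q ∧ h q ≤ E + m)
    (hp : ∀ l < Q, h (p l) = E') (hJ : 1 ≤ J)
    (hle : ∀ t, (boundaries P.time t a b).card ≤ J)
    (hge : ∀ l < Q, J ≤ (boundaries P.time (T l) (α l) (γ l)).card)
    (hsep : E' + (J + 1) * m + 1 ≤ E) : (Q : ℤ) ≤ D + 3 := by
  have hlt : ∀ i l, i < l → l < Q → γ i ≤ p l := by
    intro i l hil
    induction l, hil using Nat.le_induction with
    | base => exact fun hl => hsucc i hl
    | succ l hl ih =>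
      intro h1
      have h2 := ih (by omega)
      have h3 := hpos l (by omega)
      have h4 := hsucc l h1
      omega
  have hstrip := fun l (hl : l < Q) => P.strips (t := T l) ((hpos l hl).1.trans (hpos l hl).2.1)
    (hpos l hl).2.2.1 (hpos l hl).2.2.2 (hle _) (hge l hl)
  have hne := fun l (hl : l < Q) => exists_of_boundaries_nonempty
    (Finset.card_pos.1 (by have := hge l hl; omega) :
      (boundaries P.time (T l) (α l) (γ l)).Nonempty)
  -- Subfactor `i` lies in the uniform left strip of subfactor `l`. At time `T i` it has both an
  -- erased and a surviving letter: the erased one stays erased later, the surviving one was already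
  -- there earlier. Either decides the status of the strip.
  have left_iff : ∀ i l, i < l → l < Q →
      (T i ≤ T l → P.time a < T l) ∧ (T l ≤ T i → ¬ P.time a < T l) := by
    intro i l hil hl
    have hi := hpos i (by omega)
    have hl' := hpos l hl
    have h1 := hlt i l hil hl
    obtain ⟨⟨q, hq1, hq2, hq3⟩, ⟨r, hr1, hr2, hr3⟩⟩ := hne i (by omega)
    refine ⟨fun hT => ((hstrip l hl).1 q (by omega) (by omega)).1 (by omega), fun hT hc => ?_⟩
    have := ((hstrip l hl).1 r (by omega) (by omega)).2 hc
    omega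
  have right_iff : ∀ i l, i < l → l < Q →
      (T l ≤ T i → P.time (b - 1) < T i) ∧ (T i ≤ T l → ¬ P.time (b - 1) < T i) := by
    intro i l hil hl
    have hi := hpos i (by omega)
    have hl' := hpos l hl
    have h1 := hlt i l hil hl
    obtain ⟨⟨q, hq1, hq2, hq3⟩, ⟨r, hr1, hr2, hr3⟩⟩ := hne l hl
    refine ⟨fun hT => ((hstrip i (by omega)).2 q (by omega) (by omega)).1 (by omega),
      fun hT hc => ?_⟩
    have := ((hstrip i (by omega)).2 r (by omega) (by omega)).2 hc
    omega
  have hD : 0 ≤ D := by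
    by_contra hD
    have h1 := P.bal_nonneg 0 b
    have h2 := P.bal_le 0 b hbN
    omega
  by_contra hQ
  have hQ3 : 3 < Q := by omega
  have hmem := hpos 0 (by omega)
  have hm : 0 ≤ m := by
    have h1 := hin 0 (by omega) (α 0) le_rfl hmem.2.2.1.le
    linarith [h1.1, h1.2]
  have change : ∀ l < Q, |P.bal (T l) (γ l) - P.bal (T l) (α l)| ≤ (J + 1) * m := by
    intro l hl
    have h1 := hpos l hl
    refine (P.abs_bal_sub_le _ h1.2.2.1.le (by omega) (hin l hl) rfl).trans ?_
    have h2 : (boundaries P.time (T l) (α l) (γ l)).card ≤ J :=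
      (Finset.card_le_card (boundaries_subset (by omega) (by omega))).trans (hle _)
    have h3 : ((boundaries P.time (T l) (α l) (γ l)).card : ℤ) ≤ J := by exact_mod_cast h2
    exact mul_le_mul_of_nonneg_right (by linarith) hm
  -- The order of the first two moments fixes the direction of the sweep: left to right here, right
  -- to left in the mirror case.
  rcases le_total (T 0) (T 1) with h01 | h01
  · have hR0 := (right_iff 0 1 (by omega) (by omega)).2 h01
    have h0l : ∀ l, 0 < l → l < Q → T 0 ≤ T l := by
      intro l h1 h2
      by_contra h3
      exact hR0 ((right_iff 0 l h1 h2).1 (by omega))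
    have hL : ∀ l, 0 < l → l < Q → P.time a < T l := fun l h1 h2 =>
      (left_iff 0 l h1 h2).1 (h0l l h1 h2)
    have hinc : ∀ l, 0 < l → l + 1 < Q → T l ≤ T (l + 1) := by
      intro l h1 h2
      by_contra h3
      exact (left_iff l (l + 1) (by omega) h2).2 (by omega) (hL (l + 1) (by omega) h2)
    have hR : ∀ l, 0 < l → l + 1 < Q → ¬ P.time (b - 1) < T l := fun l h1 h2 =>
      (right_iff l (l + 1) (by omega) h2).2 (hinc l h1 h2)
    have left_eq : ∀ l, 0 < l → l < Q → ∀ q, a ≤ q → q ≤ α l →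
        P.bal (T l) q - P.bal (T l) a = h q - h a := by
      intro l h1 h2 q h3 h4
      have h5 := hpos l h2
      exact P.bal_sub_of_erased h3 (by omega) fun r h6 h7 =>
        ((hstrip l h2).1 r h6 (by omega)).2 (hL l h1 h2)
    have right_eq : ∀ l, 0 < l → l + 1 < Q → ∀ q, γ l ≤ q → q ≤ b →
        P.bal (T l) b = P.bal (T l) q := by
      intro l h1 h2 q h3 h4
      have h5 := hpos l (by omega)
      exact P.bal_eq_of_not_erased h4 hbN fun r h6 h7 => not_lt.1 fun h8 =>
        hR l h1 h2 (((hstrip l (by omega)).2 r (by omega) h7).1 h8)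
    -- At `T l` nothing right of `γ l` is erased, so the balance at `b` equals that at the valley `p
    -- (l + 1)`, which can only have grown by `T (l + 1)`. By then the climb from the valley to `α
    -- (l + 1)` is erased, gaining `E - E'`; crossing the subfactor loses at most `(J + 1) * m`, and
    -- beyond it the balance is constant up to `b`.
    have step : ∀ l, 0 < l → l + 2 < Q → P.bal (T l) b + 1 ≤ P.bal (T (l + 1)) b := by
      intro l h1 h2
      have h3 := hpos l (by omega)
      have h4 := hpos (l + 1) (by omega)
      have h5 := hsucc l (by omega)
      have e1 := right_eq l h1 (by omega) (p (l + 1)) h5 (by omega)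
      have e2 := left_eq (l + 1) (by omega) (by omega) (p (l + 1)) h4.1 h4.2.1
      have e3 := left_eq (l + 1) (by omega) (by omega) (α (l + 1)) (by omega) le_rfl
      have e4 := right_eq (l + 1) (by omega) (by omega) (γ (l + 1)) le_rfl h4.2.2.2
      have e5 := (abs_le.1 (change (l + 1) (by omega))).1
      have e6 := P.bal_mono (p (l + 1)) _ _ (hinc l h1 (by omega))
      rw [hp (l + 1) (by omega)] at e2
      rw [hα (l + 1) (by omega)] at e3
      linarith
    have grow : ∀ l : ℕ, l + 2 < Q → (l : ℤ) ≤ P.bal (T (l + 1)) b := by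
      intro l
      induction l with
      | zero => exact fun _ => by simpa using P.bal_nonneg _ _
      | succ l ih =>
        intro h1
        have h2 := ih (by omega)
        have h3 := step (l + 1) (by omega) (by omega)
        push_cast
        linarith
    -- Index 0 only fixes the direction and the last index has no right neighbour to fix its right
    -- strip; these losses account for the 3.
    have h1 := grow (Q - 3) (by omega)
    have h2 := P.bal_le (T (Q - 3 + 1)) b hbN
    omega
  · have hR0 := (right_iff 0 1 (by omega) (by omega)).1 h01
    have h0l : ∀ l, 0 < l → l < Q → T l ≤ T 0 := by
      intro l h1 h2
      by_contra h3
      exact (right_iff 0 l h1 h2).2 (by omega) hR0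
    have hL : ∀ l, 0 < l → l < Q → ¬ P.time a < T l := fun l h1 h2 =>
      (left_iff 0 l h1 h2).2 (h0l l h1 h2)
    have hdec : ∀ l, 0 < l → l + 1 < Q → T (l + 1) ≤ T l := by
      intro l h1 h2
      by_contra h3
      exact hL (l + 1) (by omega) h2 ((left_iff l (l + 1) (by omega) h2).1 (by omega))
    have hR : ∀ l, 0 < l → l + 1 < Q → P.time (b - 1) < T l := fun l h1 h2 =>
      (right_iff l (l + 1) (by omega) h2).1 (hdec l h1 h2)
    have left_eq : ∀ l, 0 < l → l < Q → ∀ q, a ≤ q → q ≤ α l →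
        P.bal (T l) q = P.bal (T l) a := by
      intro l h1 h2 q h3 h4
      have h5 := hpos l h2
      exact P.bal_eq_of_not_erased h3 (by omega) fun r h6 h7 => not_lt.1 fun h8 =>
        hL l h1 h2 (((hstrip l h2).1 r h6 (by omega)).1 h8)
    have right_eq : ∀ l, 0 < l → l + 1 < Q → ∀ q, γ l ≤ q → q ≤ b →
        P.bal (T l) b - P.bal (T l) q = h b - h q := by
      intro l h1 h2 q h3 h4
      have h5 := hpos l (by omega)
      exact P.bal_sub_of_erased h4 hbN fun r h6 h7 =>
        ((hstrip l (by omega)).2 r (by omega) h7).2 (hR l h1 h2)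
    -- Mirror image: the right strips are now the erased ones, and the balance at `a` falls from at
    -- most `D` without going below 0.
    have step : ∀ l, 0 < l → l + 2 < Q → P.bal (T (l + 1)) a + 1 ≤ P.bal (T l) a := by
      intro l h1 h2
      have h3 := hpos l (by omega)
      have h4 := hpos (l + 1) (by omega)
      have h5 := hsucc l (by omega)
      have e1 := right_eq l h1 (by omega) (p (l + 1)) h5 (by omega)
      have e2 := left_eq (l + 1) (by omega) (by omega) (p (l + 1)) h4.1 h4.2.1
      have e3 := left_eq l (by omega) (by omega) (α l) (by omega) le_rfl
      have e4 := right_eq l (by omega) (by omega) (γ l) le_rfl h3.2.2.2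
      have e5 := (abs_le.1 (change l (by omega))).2
      have e6 := P.bal_mono (p (l + 1)) _ _ (hdec l h1 (by omega))
      rw [hp (l + 1) (by omega)] at e1
      rw [hγ l (by omega)] at e4
      linarith
    have grow : ∀ l : ℕ, l + 2 < Q → P.bal (T (l + 1)) a ≤ D - l := by
      intro l
      induction l with
      | zero => exact fun _ => by simpa [ha] using P.bal_le (T 1) a (by omega)
      | succ l ih =>
        intro h1
        have h2 := ih (by omega)
        have h3 := step (l + 1) (by omega) (by omega)
        push_cast
        linarith
    have h1 := grow (Q - 3) (by omega)
    have h2 := P.bal_nonneg (T (Q - 3 + 1)) a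
    omega

end Play

/-! ### Heights, and the copies of smaller trees inside `Z n`. -/

/-- The balance of a list of brackets. -/
def balance (l : List DyckStep) : ℤ := (l.count DyckStep.U : ℤ) - l.count DyckStep.D

theorem balance_append (l l' : List DyckStep) : balance (l ++ l') = balance l + balance l' := by
  simp [balance, List.count_append]; ring

theorem balance_toList (w : DyckWord) : balance w.toList = 0 := by
  simp [balance, w.count_U_eq_count_D]

theorem balance_take_nonneg (w : DyckWord) (i : ℕ) : 0 ≤ balance (w.toList.take i) := by
  have := w.count_D_le_count_U i
  simp only [balance]; omega

/-- The height function of a list of brackets. -/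
def height (l : List DyckStep) (p : ℕ) : ℤ := balance (l.take p)

theorem height_append (l l' : List DyckStep) (i : ℕ) :
    height (l ++ l') (l.length + i) = balance l + height l' i := by
  simp [height, List.take_append, balance_append, List.take_of_length_le]

theorem height_append_left {l : List DyckStep} (l' : List DyckStep) {i : ℕ} (hi : i ≤ l.length) :
    height (l ++ l') i = height l i := by
  simp [height, List.take_append_of_le_length hi]

theorem height_length (l : List DyckStep) : height l l.length = balance l := by simp [height]

theorem height_Z_le (m : ℕ) : ∀ i ≤ (Z m).toList.length, height (Z m).toList i ≤ m := by
  induction m with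
  | zero => intro i _; simp [height, Z, balance, DyckWord.toList_eq_nil.2 rfl]
  | succ m ih =>
    intro i hi
    rw [Z_succ] at hi ⊢
    set L := (Z m).toList.length with hL
    have h1 : balance [DyckStep.U] = 1 := rfl
    have h2 : balance [DyckStep.D] = -1 := rfl
    have hZ : balance (Z m).toList = 0 := balance_toList _
    simp only [List.length_append, List.length_singleton, ← hL] at hi
    rcases Nat.eq_zero_or_pos i with rfl | hi0
    · simp [height, balance]; positivity
    obtain ⟨j, rfl⟩ : ∃ j, i = 1 + j := ⟨i - 1, by omega⟩
    rw [List.append_assoc]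
    have := height_append [DyckStep.U] ((Z m).toList ++ (Z m).toList ++ [DyckStep.D]) j
    rw [List.length_singleton] at this
    rw [this, h1]
    push_cast
    suffices height ((Z m).toList ++ (Z m).toList ++ [DyckStep.D]) j ≤ m by linarith
    rcases le_total j L with hj | hj
    · rw [List.append_assoc, height_append_left _ hj]
      exact ih j hj
    obtain ⟨j, rfl⟩ : ∃ i, j = L + i := ⟨j - L, by omega⟩
    rw [List.append_assoc, height_append, hZ, zero_add]
    rcases le_total j L with hj' | hj'
    · rw [height_append_left _ hj']
      exact ih j hj'
    obtain ⟨j, rfl⟩ : ∃ i, j = L + i := ⟨j - L, by omega⟩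
    rw [height_append, hZ, zero_add]
    have : j = 0 ∨ j = 1 := by omega
    rcases this with rfl | rfl
    · simp [height, balance]
    · simp [height, balance]

theorem length_Z_add_two (m : ℕ) : (Z m).toList.length + 2 = 2 ^ (m + 1) := by
  induction m with
  | zero => rw [show (Z 0).toList = [] from rfl]; rfl
  | succ m ih =>
    rw [Z_succ, pow_succ]
    simp only [List.length_append, List.length_singleton]
    omega

/-- The word `Z m` occurs in `l` at position `a`. -/
def FactorAt (l : List DyckStep) (a m : ℕ) : Prop :=
  ∃ u v, l = u ++ (Z m).toList ++ v ∧ u.length = a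

theorem factorAt_self (n : ℕ) : FactorAt (Z n).toList 0 n := ⟨[], [], by simp, rfl⟩

namespace FactorAt

variable {l : List DyckStep} {a m : ℕ}

theorem add_length_le (H : FactorAt l a m) : a + (Z m).toList.length ≤ l.length := by
  obtain ⟨u, v, rfl, rfl⟩ := H
  simp only [List.length_append]; omega

theorem height_add (H : FactorAt l a m) {i : ℕ} (hi : i ≤ (Z m).toList.length) :
    height l (a + i) = height l a + height (Z m).toList i := by
  obtain ⟨u, v, rfl, rfl⟩ := H
  rw [List.append_assoc, height_append, height_append_left _ hi, height_append_left _ le_rfl,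
    height_length]

theorem height_end (H : FactorAt l a m) : height l (a + (Z m).toList.length) = height l a := by
  rw [H.height_add le_rfl, height_length, balance_toList, add_zero]

theorem height_mem (H : FactorAt l a m) {q : ℕ} (h1 : a ≤ q) (h2 : q ≤ a + (Z m).toList.length) :
    height l a ≤ height l q ∧ height l q ≤ height l a + m := by
  obtain ⟨i, rfl⟩ : ∃ i, q = a + i := ⟨q - a, by omega⟩
  have hi : i ≤ (Z m).toList.length := by omega
  rw [H.height_add hi]
  have := balance_take_nonneg (Z m) i
  have := height_Z_le m i hi
  simp only [height] at *
  constructor <;> linarith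

theorem left (H : FactorAt l a (m + 1)) :
    FactorAt l (a + 1) m ∧ height l (a + 1) = height l a + 1 := by
  refine ⟨?_, ?_⟩
  · obtain ⟨u, v, rfl, rfl⟩ := H
    exact ⟨u ++ [DyckStep.U], (Z m).toList ++ [DyckStep.D] ++ v, by simp [Z_succ], by simp⟩
  · rw [H.height_add (by simp [Z_succ])]
    simp [Z_succ, height, balance]

theorem right (H : FactorAt l a (m + 1)) :
    FactorAt l (a + 1 + (Z m).toList.length) m ∧
      height l (a + 1 + (Z m).toList.length) = height l a + 1 := by
  refine ⟨?_, ?_⟩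
  · obtain ⟨u, v, rfl, rfl⟩ := H
    exact ⟨u ++ [DyckStep.U] ++ (Z m).toList, [DyckStep.D] ++ v, by simp [Z_succ], by simp; omega⟩
  · rw [H.left.1.height_end, H.left.2]

theorem leftmost (s : ℕ) : ∀ {a}, FactorAt l a (m + s) →
    FactorAt l (a + s) m ∧ height l (a + s) = height l a + s := by
  induction s with
  | zero => intro a H; simpa using H
  | succ s ih =>
    intro a H
    obtain ⟨h1, h2⟩ := left (m := m + s) H
    obtain ⟨h3, h4⟩ := ih h1
    rw [show a + (s + 1) = a + 1 + s by ring]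
    refine ⟨h3, ?_⟩
    rw [h4, h2]; push_cast; ring

/-- These are the subtrees at depth `s`, enumerated from left to right; they supply the many
disjoint subfactors for the sweep. -/
theorem descendants (s : ℕ) : ∀ {a}, FactorAt l a (m + s) → ∃ g : ℕ → ℕ,
    (∀ i < 2 ^ s, FactorAt l (g i) m ∧ a ≤ g i ∧
      g i + (Z m).toList.length ≤ a + (Z (m + s)).toList.length ∧
      height l (g i) = height l a + s) ∧
    ∀ i, i + 1 < 2 ^ s → g i + (Z m).toList.length ≤ g (i + 1) := by
  induction s with
  | zero =>
    intro a H
    refine ⟨fun _ => a, fun i _ => ⟨H, le_rfl, le_rfl, by simp⟩, fun i hi => ?_⟩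
    simp at hi
  | succ s ih =>
    intro a H
    obtain ⟨h1, h2⟩ := left (m := m + s) H
    obtain ⟨h3, h4⟩ := right (m := m + s) H
    obtain ⟨g, hg, hg'⟩ := ih h1
    obtain ⟨f, hf, hf'⟩ := ih h3
    have hlen : (Z (m + (s + 1))).toList.length =
        1 + ((Z (m + s)).toList.length + (Z (m + s)).toList.length) + 1 := by
      rw [← add_assoc, Z_succ]; simp; omega
    refine ⟨fun i => if i < 2 ^ s then g i else f (i - 2 ^ s), fun i hi => ?_, fun i hi => ?_⟩
    · rw [pow_succ] at hi
      by_cases hc : i < 2 ^ s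
      · simp only [hc, if_true]
        obtain ⟨k1, k2, k3, k4⟩ := hg i hc
        exact ⟨k1, by omega, by omega, by rw [k4, h2]; push_cast; ring⟩
      · simp only [hc, if_false]
        obtain ⟨k1, k2, k3, k4⟩ := hf (i - 2 ^ s) (by omega)
        exact ⟨k1, by omega, by omega, by rw [k4, h4]; push_cast; ring⟩
    · rw [pow_succ] at hi
      dsimp only
      rcases lt_trichotomy (i + 1) (2 ^ s) with hc | hc | hc
      · simp only [hc, if_true, (by omega : i < 2 ^ s)]
        exact hg' i hc
      · rw [if_pos (by omega : i < 2 ^ s), if_neg (by omega), hc, Nat.sub_self]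
        have k1 := hg i (by omega)
        have k2 := hf 0 (by positivity)
        omega
      · rw [if_neg (by omega : ¬ i < 2 ^ s), if_neg (by omega)]
        have := hf' (i - 2 ^ s) (by omega)
        rwa [show i - 2 ^ s + 1 = i + 1 - 2 ^ s by omega] at this

end FactorAt

/-! ### The induction on the number of boundaries. -/

/-- Every occurrence of `Z m` with `m = (K + 2) ^ j * (s + 2)` has `j + 1` boundaries at some
time, if the number of boundaries in the whole word never exceeds `K`. -/
theorem exists_boundaries {l : List DyckStep} (P : Play (height l) l.length) {K s : ℕ}
    (hK : ∀ t, (boundaries P.time t 0 l.length).card ≤ K)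
    (hs : ∀ p ≤ l.length, height l p + 4 ≤ 2 ^ s) (j : ℕ) :
    ∀ a, FactorAt l a ((K + 4) ^ j * (s + 2)) →
      ∃ t, j + 1 ≤ (boundaries P.time t a
        (a + (Z ((K + 4) ^ j * (s + 2))).toList.length)).card := by
  induction j with
  | zero =>
    intro a H
    simp only [pow_zero, one_mul, zero_add, Nat.one_le_iff_ne_zero, ← Nat.pos_iff_ne_zero,
      Finset.card_pos] at H ⊢
    have h1 := H.add_length_le
    have h2 := length_Z_add_two (s + 2)
    have h3 : 2 ^ (s + 2 + 1) = 2 ^ s * 8 := by ring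
    have h4 : 1 ≤ 2 ^ s := Nat.one_le_two_pow
    have key : ∀ q, a < q → q < a + (Z (s + 2)).toList.length → P.time a ≠ P.time q →
        ∃ t, (boundaries P.time t a (a + (Z (s + 2)).toList.length)).Nonempty := by
      intro q hq1 hq2 hne
      rcases lt_or_gt_of_ne hne with hlt | hlt
      · exact ⟨P.time q, boundaries_nonempty le_rfl hq1 hq2 (by simp [hlt])⟩
      · exact ⟨P.time a, boundaries_nonempty le_rfl hq1 hq2 (by simp [hlt])⟩
    by_contra hcon
    -- A move erases only two letters, so three letters cannot all share a time, and two with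
    -- different times are separated at the later one.
    have e1 : P.time a = P.time (a + 1) := by
      by_contra hne; exact hcon (key _ (by omega) (by omega) hne)
    have e2 : P.time a = P.time (a + 2) := by
      by_contra hne; exact hcon (key _ (by omega) (by omega) hne)
    exact P.not_three a (a + 1) (a + 2) (by omega) (by omega) (by omega) ⟨e1, e1 ▸ e2⟩
  | succ j ih =>
    intro a H
    set m := (K + 4) ^ j * (s + 2) with hm
    have hmpos : s + 2 ≤ m := Nat.le_mul_of_pos_left _ (by positivity)
    -- The outer `m` levels branch into `2 ^ m` subtrees, the next `(K + 2) * m` levels descend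
    -- leftmost to gain height, and the last `m` levels are a copy for the induction hypothesis.
    have hsplit : (K + 4) ^ (j + 1) * (s + 2) = (m + (K + 2) * m) + m := by
      rw [pow_succ, hm]; ring
    rw [hsplit] at H ⊢
    by_contra hcon
    push Not at hcon
    set L := (Z m).toList.length
    set M := (Z (m + (K + 2) * m)).toList.length with hM
    set b := a + (Z (m + (K + 2) * m + m)).toList.length with hb
    have hbl : b ≤ l.length := H.add_length_le
    obtain ⟨g, hg, hg'⟩ := H.descendants
    have hlm := fun i (hi : i < 2 ^ m) => (hg i hi).1.leftmost
    have hT : ∀ i, ∃ t, i < 2 ^ m →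
        j + 1 ≤ (boundaries P.time t (g i + (K + 2) * m) (g i + (K + 2) * m + L)).card := by
      intro i
      by_cases hi : i < 2 ^ m
      · obtain ⟨t, ht⟩ := ih _ (hlm i hi).1
        exact ⟨t, fun _ => ht⟩
      · exact ⟨0, fun h => absurd h hi⟩
    choose T hT using hT
    have hend : ∀ i < 2 ^ m, g i + (K + 2) * m + L ≤ g i + M := by
      intro i hi
      have h1 := length_Z_add_two m
      have h2 := length_Z_add_two (m + (K + 2) * m)
      have h3 : 2 ^ (m + (K + 2) * m + 1) = 2 ^ (m + 1) * 2 ^ ((K + 2) * m) := by ring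
      have h4 : (K + 2) * m + 1 ≤ 2 ^ ((K + 2) * m) := Nat.lt_two_pow_self
      have h5 : 2 ^ (m + 1) * ((K + 2) * m + 1) ≤ 2 ^ (m + 1) * 2 ^ ((K + 2) * m) :=
        Nat.mul_le_mul_left _ h4
      have h6 : (K + 2) * m ≤ 2 ^ (m + 1) * ((K + 2) * m) :=
        Nat.le_mul_of_pos_left _ (by positivity)
      rw [Nat.mul_add, mul_one] at h5
      omega
    have hLpos : 0 < L := by
      have h1 := length_Z_add_two m
      have h2 : m + 1 < 2 ^ (m + 1) := Nat.lt_two_pow_self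
      omega
    have hjK : j + 1 ≤ K := by
      have h0 : 0 < 2 ^ m := by positivity
      have h1 := hend 0 h0
      have h2 := hg 0 h0
      exact (hT 0 h0).trans ((Finset.card_le_card
        (boundaries_subset (Nat.zero_le _) (by omega))).trans (hK _))
    -- The valleys are the starts `g i`. Since `j + 1 ≤ K`, the climb `(K + 2) * m` exceeds the
    -- permitted loss `(j + 2) * m` by at least `m ≥ 1`.
    have hsw := P.sweep (a := a) (b := b) (J := j + 1) (Q := 2 ^ m) (D := height l a)
      (E := height l a + (m + (K + 2) * m : ℕ)) (E' := height l a + m) (m := m)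
      g (fun i => g i + (K + 2) * m) (fun i => g i + (K + 2) * m + L) T hbl rfl H.height_end
      (fun i hi => by have h1 := hg i hi; have h2 := hend i hi; omega)
      (fun i hi => by have h1 := hg' i hi; have h2 := hend i (by omega); omega)
      (fun i hi => by
        have h1 := (hg i hi).2.2.2; have h2 := (hlm i hi).2
        rw [h2, h1]; push_cast; ring)
      (fun i hi => by
        have h1 := (hg i hi).2.2.2; have h2 := (hlm i hi).2
        rw [(hlm i hi).1.height_end, h2, h1]; push_cast; ring)
      (fun i hi q h3 h4 => by
        have h1 := (hg i hi).2.2.2; have h2 := (hlm i hi).2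
        have h5 := (hlm i hi).1.height_mem h3 h4
        rw [h2, h1] at h5
        push_cast at h5 ⊢
        constructor <;> linarith [h5.1, h5.2])
      (fun i hi => (hg i hi).2.2.2) (by omega)
      (fun t => by have := hcon t; omega) hT (by
        have h1 : ((j : ℤ) + 1 + 1) * m + m ≤ (K + 2) * m := by
          have h2 : (j : ℤ) + 1 ≤ K := by exact_mod_cast hjK
          have h3 : (j : ℤ) + 1 + 1 + 1 ≤ K + 2 := by linarith
          have h4 := mul_le_mul_of_nonneg_right h3 (by positivity : (0 : ℤ) ≤ m)
          linarith
        have h2 : (1 : ℤ) ≤ m := by exact_mod_cast (by omega : 1 ≤ m)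
        push_cast
        linarith)
    have h1 := hs a (by omega)
    have h2 : (2 : ℤ) ^ s ≤ 2 ^ m := pow_le_pow_right₀ (by norm_num) (by omega)
    push_cast at hsw
    linarith

/-! ### Interval width against boundaries. -/

theorem exists_iUnion_Icc_eq (S : Finset ℤ) :
    {k : ℕ | ∃ a b : Fin k → ℤ, (S : Set ℤ) = ⋃ i, Set.Icc (a i) (b i)}.Nonempty := by
  refine ⟨S.card, fun i => S.equivFin.symm i, fun i => S.equivFin.symm i, ?_⟩
  ext x
  simp only [Finset.mem_coe, Set.Icc_self, Set.mem_iUnion, Set.mem_singleton_iff]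
  exact ⟨fun hx => ⟨S.equivFin ⟨x, hx⟩, by simp⟩, by rintro ⟨i, rfl⟩; exact (S.equivFin.symm i).2⟩

/-- A set that is a union of `k` intervals has at most `2 * k` boundary points. -/
theorem card_boundary_le (S : Finset ℤ) (B : Finset ℕ)
    (hB : ∀ p ∈ B, ¬((p : ℤ) - 1 ∈ S ↔ (p : ℤ) ∈ S)) : B.card ≤ 2 * intervalWidth S := by
  obtain ⟨a, b, hab⟩ : ∃ a b : Fin (intervalWidth S) → ℤ, (S : Set ℤ) = ⋃ i, Set.Icc (a i) (b i) :=
    Nat.sInf_mem (exists_iUnion_Icc_eq S)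
  have hmem : ∀ x, x ∈ S ↔ ∃ i, a i ≤ x ∧ x ≤ b i := by
    intro x
    rw [← Finset.mem_coe, hab]
    simp
  have hsub : B.image (fun p : ℕ => (p : ℤ)) ⊆
      Finset.univ.image a ∪ Finset.univ.image (fun i => b i + 1) := by
    intro x hx
    obtain ⟨p, hp, rfl⟩ := Finset.mem_image.1 hx
    have h1 := hB p hp
    simp only [Finset.mem_union, Finset.mem_image, Finset.mem_univ, true_and]
    -- Entering `S` at `p` makes `p` the left end of an interval; leaving `S` makes `p - 1` a right
    -- end.
    by_cases h2 : (p : ℤ) ∈ S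
    · obtain ⟨i, h3, h4⟩ := (hmem _).1 h2
      refine Or.inl ⟨i, ?_⟩
      by_contra h5
      exact h1 ⟨fun _ => h2, fun _ => (hmem _).2 ⟨i, by omega, by omega⟩⟩
    · have h3 : (p : ℤ) - 1 ∈ S := by
        by_contra h3
        exact h1 ⟨fun h => absurd h h3, fun h => absurd h h2⟩
      obtain ⟨i, h4, h5⟩ := (hmem _).1 h3
      refine Or.inr ⟨i, ?_⟩
      by_contra h6
      exact h2 ((hmem _).2 ⟨i, by omega, by omega⟩)
  rw [← Finset.card_image_of_injective B (Nat.cast_injective (R := ℤ))]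
  refine (Finset.card_le_card hsub).trans ((Finset.card_union_le _ _).trans ?_)
  have h1 := Finset.card_image_le (s := (Finset.univ : Finset (Fin (intervalWidth S)))) (f := a)
  have h2 := Finset.card_image_le (s := (Finset.univ : Finset (Fin (intervalWidth S))))
    (f := fun i => b i + 1)
  simp only [Finset.card_univ, Fintype.card_fin] at h1 h2
  omega

/-! ### A re-pairing as an erasure order. -/

namespace Repairing

variable {w : DyckWord} (p : Repairing w)

/-- The index of the pair that contains position `q`. -/
noncomputable def index (q : ℕ) : ℕ :=
  if hq : q < w.toList.length then ((p.exactly_one ⟨q, hq⟩).choose : ℕ) else 0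

/-- The number of pairs among the first `t` that are open at `q`. -/
noncomputable def openPairs (t q : ℕ) : ℤ :=
  ∑ i : Fin (w.toList.length / 2), if (i : ℕ) < t then
    ((if (p.left i : ℕ) < q then 1 else 0) - (if (p.right i : ℕ) < q then 1 else 0)) else 0

theorem index_eq (i : Fin (w.toList.length / 2)) (q : Fin w.toList.length)
    (h : q = p.left i ∨ q = p.right i) : p.index q = i := by
  have := (p.exactly_one q).choose_spec.2 i h
  simp [index, ← this]

theorem exists_index (q : Fin w.toList.length) :
    ∃ i : Fin (w.toList.length / 2), p.index q = i ∧ (q = p.left i ∨ q = p.right i) := by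
  obtain ⟨i, hi, -⟩ := p.exactly_one q
  exact ⟨i, p.index_eq i q hi, hi⟩

theorem mem_erased {t q : ℕ} (hq : q < w.toList.length) :
    (q : ℤ) ∈ p.erased t ↔ p.index q < t := by
  obtain ⟨i, h1, h2⟩ := p.exists_index ⟨q, hq⟩
  simp only [erased, Finset.mem_biUnion, Finset.mem_filter, Finset.mem_univ, true_and,
    Finset.mem_insert, Finset.mem_singleton, Nat.cast_inj]
  constructor
  · rintro ⟨k, h3, h4⟩
    rw [show p.index q = k from p.index_eq k ⟨q, hq⟩ (by simpa [Fin.ext_iff] using h4)]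
    exact h3
  · intro h3
    refine ⟨i, by rw [← h1]; exact h3, by simpa [Fin.ext_iff] using h2⟩

theorem term_nonneg (i : Fin (w.toList.length / 2)) (q : ℕ) :
    (0 : ℤ) ≤ (if (p.left i : ℕ) < q then 1 else 0) - (if (p.right i : ℕ) < q then 1 else 0) := by
  have : (p.left i : ℕ) < p.right i := p.left_lt_right i
  split_ifs <;> omega

theorem openPairs_mono (q : ℕ) {s t : ℕ} (hst : s ≤ t) : p.openPairs s q ≤ p.openPairs t q := by
  refine Finset.sum_le_sum fun i _ => ?_
  have := p.term_nonneg i q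
  by_cases h1 : (i : ℕ) < s
  · rw [if_pos h1, if_pos (h1.trans_le hst)]
  · rw [if_neg h1]
    by_cases h2 : (i : ℕ) < t
    · rwa [if_pos h2]
    · rw [if_neg h2]

theorem openPairs_nonneg (t q : ℕ) : 0 ≤ p.openPairs t q := by
  refine Finset.sum_nonneg fun i _ => ?_
  have := p.term_nonneg i q
  by_cases h1 : (i : ℕ) < t
  · rwa [if_pos h1]
  · rw [if_neg h1]

theorem height_succ {l : List DyckStep} {q : ℕ} (hq : q < l.length) :
    height l (q + 1) = height l q + balance [l[q]] := by
  rw [height, List.take_succ_eq_append_getElem hq, balance_append]; rfl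

theorem openPairs_succ_sub (t : ℕ) (q : Fin w.toList.length) :
    p.openPairs t (q + 1) - p.openPairs t q =
      if p.index q < t then balance [w.toList.get q] else 0 := by
  obtain ⟨i, h1, h2⟩ := p.exists_index q
  rw [openPairs, openPairs, ← Finset.sum_sub_distrib, Finset.sum_eq_single i]
  · rw [h1]
    have h3 : (p.left i : ℕ) < p.right i := p.left_lt_right i
    by_cases h4 : (i : ℕ) < t
    · simp only [h4, if_true]
      rcases h2 with rfl | rfl
      · rw [p.left_open, show balance [DyckStep.U] = 1 from rfl]
        simp [(p.left_lt_right i).not_ge, (p.left_lt_right i).not_gt]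
      · rw [p.right_close, show balance [DyckStep.D] = -1 from rfl]
        simp [h3, (by omega : (p.left i : ℕ) < p.right i + 1)]
    · simp [h4]
  · intro k _ hk
    have h3 : q ≠ p.left k := fun h => hk (Fin.ext (by rw [← p.index_eq k q (Or.inl h), h1]))
    have h4 : q ≠ p.right k := fun h => hk (Fin.ext (by rw [← p.index_eq k q (Or.inr h), h1]))
    rw [Ne, Fin.ext_iff] at h3 h4
    have e1 : (p.left k : ℕ) < q + 1 ↔ (p.left k : ℕ) < q := by omega
    have e2 : (p.right k : ℕ) < q + 1 ↔ (p.right k : ℕ) < q := by omega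
    simp only [e1, e2, sub_self]
  · simp

theorem openPairs_zero (t : ℕ) : p.openPairs t 0 = 0 := by simp [openPairs]

/-- Once all pairs are played every letter counts, so both sides have the same increments. This
yields the height as an upper bound for `openPairs` at all times. -/
theorem openPairs_full (q : ℕ) (hq : q ≤ w.toList.length) :
    p.openPairs (w.toList.length / 2) q = height w.toList q := by
  induction q with
  | zero => rw [openPairs_zero]; simp [height, balance]
  | succ q ih =>
    have h1 := p.openPairs_succ_sub (w.toList.length / 2) ⟨q, hq⟩
    obtain ⟨i, h2, -⟩ := p.exists_index ⟨q, hq⟩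
    rw [if_pos (by rw [h2]; exact i.2)] at h1
    have h3 := ih (by omega)
    have h4 := height_succ (l := w.toList) (q := q) hq
    simp only [List.get_eq_getElem] at h1
    linarith

theorem openPairs_le (t q : ℕ) (hq : q ≤ w.toList.length) :
    p.openPairs t q ≤ height w.toList q := by
  rw [← p.openPairs_full q hq]
  refine Finset.sum_le_sum fun i _ => ?_
  have := p.term_nonneg i q
  rw [if_pos i.2]
  by_cases h1 : (i : ℕ) < t
  · rw [if_pos h1]
  · rw [if_neg h1]; exact this

/-- The order of erasure given by a re-pairing. -/
noncomputable def toPlay : Play (height w.toList) w.toList.length where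
  time := p.index
  bal := p.openPairs
  bal_mono q _ _ h := p.openPairs_mono q h
  bal_nonneg := p.openPairs_nonneg
  bal_le := p.openPairs_le
  bal_succ_of_lt t q hq h := by
    have h1 := p.openPairs_succ_sub t ⟨q, hq⟩
    have h2 := height_succ (l := w.toList) (q := q) hq
    rw [if_pos h] at h1
    simp only [List.get_eq_getElem] at h1
    linarith
  bal_succ_of_le t q hq h := by
    have h1 := p.openPairs_succ_sub t ⟨q, hq⟩
    rw [if_neg (not_lt.2 h)] at h1
    exact sub_eq_zero.1 h1
  not_three q r s hqr hrs hs := by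
    rintro ⟨e1, e2⟩
    obtain ⟨i, a1, a2⟩ := p.exists_index ⟨q, by omega⟩
    obtain ⟨j, b1, b2⟩ := p.exists_index ⟨r, by omega⟩
    obtain ⟨k, c1, c2⟩ := p.exists_index ⟨s, hs⟩
    simp only at a1 b1 c1
    obtain rfl : i = j := Fin.ext (by omega)
    obtain rfl : i = k := Fin.ext (by omega)
    simp only [Fin.ext_iff] at a2 b2 c2
    omega

theorem card_boundaries_le (t : ℕ) :
    (boundaries p.toPlay.time t 0 w.toList.length).card ≤ 2 * p.width := by
  -- The width only inspects times up to half the length; nothing changes afterwards, so `t` can be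
  -- truncated.
  have key : ∀ q < w.toList.length, p.index q < t ↔
      (q : ℤ) ∈ p.erased (min t (w.toList.length / 2)) := by
    intro q hq
    obtain ⟨i, h1, -⟩ := p.exists_index ⟨q, hq⟩
    have := i.2
    simp only at h1
    rw [p.mem_erased hq]
    omega
  refine (card_boundary_le (p.erased (min t (w.toList.length / 2))) _ fun q hq => ?_).trans
    (Nat.mul_le_mul_left 2 (Finset.le_sup (f := fun t => intervalWidth (p.erased t))
      (Finset.mem_range.2 (by omega))))
  obtain ⟨⟨h1, h2⟩, h3⟩ := mem_boundaries.1 hq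
  have h4 := key q h2
  have h5 := key (q - 1) (by omega)
  rw [Nat.cast_sub (by omega), Nat.cast_one] at h5
  rw [← h4, ← h5]
  exact h3

end Repairing

/-! ### Existence of a re-pairing of `Z n`. -/

/-- A list of pairs of positions that matches all the brackets of `l`. -/
def Matches (l : List DyckStep) (L : List (ℕ × ℕ)) : Prop :=
  2 * L.length = l.length ∧
  (∀ x ∈ L, x.1 < x.2 ∧ l[x.1]? = some DyckStep.U ∧ l[x.2]? = some DyckStep.D) ∧
  ∀ q < l.length, ∃ x ∈ L, q = x.1 ∨ q = x.2

theorem Matches.append {l l' : List DyckStep} {L L' : List (ℕ × ℕ)} (H : Matches l L)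
    (H' : Matches l' L') :
    Matches (l ++ l') (L ++ L'.map fun x => (l.length + x.1, l.length + x.2)) := by
  obtain ⟨h1, h2, h3⟩ := H
  obtain ⟨h1', h2', h3'⟩ := H'
  refine ⟨by simp; omega, fun x hx => ?_, fun q hq => ?_⟩
  · rw [List.mem_append, List.mem_map] at hx
    rcases hx with hx | ⟨y, hy, rfl⟩
    · obtain ⟨k1, k2, k3⟩ := h2 x hx
      obtain ⟨k4, -⟩ := List.getElem?_eq_some_iff.1 k2
      obtain ⟨k5, -⟩ := List.getElem?_eq_some_iff.1 k3
      exact ⟨k1, by rw [List.getElem?_append_left k4, k2], by rw [List.getElem?_append_left k5, k3]⟩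
    · obtain ⟨k1, k2, k3⟩ := h2' y hy
      refine ⟨by simpa using k1, ?_, ?_⟩
      · simpa [List.getElem?_append_right] using k2
      · simpa [List.getElem?_append_right] using k3
  · rw [List.length_append] at hq
    by_cases hc : q < l.length
    · obtain ⟨x, hx, h⟩ := h3 q hc
      exact ⟨x, by simp [hx], h⟩
    · obtain ⟨x, hx, h⟩ := h3' (q - l.length) (by omega)
      exact ⟨(l.length + x.1, l.length + x.2),
        List.mem_append_right _ (List.mem_map_of_mem hx), by dsimp only; omega⟩

theorem Matches.nest {l : List DyckStep} {L : List (ℕ × ℕ)} (H : Matches l L) :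
    Matches ([DyckStep.U] ++ l ++ [DyckStep.D])
      ((0, l.length + 1) :: L.map fun x => (x.1 + 1, x.2 + 1)) := by
  obtain ⟨h1, h2, h3⟩ := H
  refine ⟨by simp; omega, fun x hx => ?_, fun q hq => ?_⟩
  · rw [List.mem_cons, List.mem_map] at hx
    rcases hx with rfl | ⟨y, hy, rfl⟩
    · simp
    · obtain ⟨k1, k2, k3⟩ := h2 y hy
      obtain ⟨k4, -⟩ := List.getElem?_eq_some_iff.1 k2
      obtain ⟨k5, -⟩ := List.getElem?_eq_some_iff.1 k3
      refine ⟨by simpa using k1, ?_, ?_⟩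
      · simpa [List.getElem?_append_left k4] using k2
      · simpa [List.getElem?_append_left k5] using k3
  · simp only [List.length_append, List.length_singleton] at hq
    rcases Nat.eq_zero_or_pos q with rfl | hq0
    · exact ⟨_, List.mem_cons_self, Or.inl rfl⟩
    by_cases hc : q = l.length + 1
    · exact ⟨_, List.mem_cons_self, Or.inr hc⟩
    · obtain ⟨x, hx, h⟩ := h3 (q - 1) (by omega)
      exact ⟨(x.1 + 1, x.2 + 1), List.mem_cons_of_mem _ (List.mem_map_of_mem hx),
        by dsimp only; omega⟩

theorem exists_matches_Z (n : ℕ) : ∃ L, Matches (Z n).toList L := by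
  induction n with
  | zero => exact ⟨[], by simp [Matches, show (Z 0).toList = [] from rfl]⟩
  | succ n ih =>
    obtain ⟨L, hL⟩ := ih
    exact ⟨_, (hL.append hL).nest⟩

theorem nonempty_repairing_of_matches {w : DyckWord} {L : List (ℕ × ℕ)}
    (H : Matches w.toList L) : Nonempty (Repairing w) := by
  obtain ⟨h1, h2, h3⟩ := H
  have hlen : w.toList.length / 2 = L.length := by omega
  have hg := fun i : Fin (w.toList.length / 2) =>
    h2 (L.get (i.cast hlen)) (List.get_mem _ _)
  have hl := fun i => List.getElem?_eq_some_iff.1 (hg i).2.1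
  have hr := fun i => List.getElem?_eq_some_iff.1 (hg i).2.2
  let f : Fin (w.toList.length / 2) × Bool → Fin w.toList.length := fun x =>
    if x.2 then ⟨_, (hr x.1).1⟩ else ⟨_, (hl x.1).1⟩
  have hsurj : Function.Surjective f := by
    intro q
    obtain ⟨x, hx, hq⟩ := h3 q q.2
    obtain ⟨i, rfl⟩ := List.get_of_mem hx
    rcases hq with hq | hq
    · exact ⟨(i.cast hlen.symm, false), Fin.ext (by simp [f, hq])⟩
    · exact ⟨(i.cast hlen.symm, true), Fin.ext (by simp [f, hq])⟩
  -- Covering all positions with exactly as many slots as positions leaves no repetition, which is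
  -- why `Matches` need not ask for disjointness.
  have hinj : Function.Injective f :=
    ((Fintype.bijective_iff_surjective_and_card f).2 ⟨hsurj, by simp; omega⟩).1
  refine ⟨⟨fun i => f (i, false), fun i => f (i, true), fun i => ?_, fun i => ?_, fun i => ?_,
    fun q => ?_⟩⟩
  · exact (hl i).2
  · exact (hr i).2
  · exact (hg i).1
  · obtain ⟨⟨i, c⟩, rfl⟩ := hsurj q
    refine ⟨i, by cases c <;> simp, ?_⟩
    rintro j (hj | hj)
    · exact (congrArg Prod.fst (hinj hj)).symm
    · exact (congrArg Prod.fst (hinj hj)).symm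

/-- Nonemptiness matters: the infimum over an empty set of re-pairings would be 0 and the lower
bound meaningless. -/
theorem exists_repairing_width_eq (n : ℕ) :
    ∃ p : Repairing (Z n), p.width = width (Z n) := by
  obtain ⟨L, hL⟩ := exists_matches_Z n
  obtain ⟨p⟩ := nonempty_repairing_of_matches hL
  exact Nat.sInf_mem ⟨_, Set.mem_range_self p⟩

/-! ### The bound in finite form and its asymptotics. -/

/-- The lower bound on the width of `Z n` in finite form. -/
theorem lt_of_width {n s : ℕ} (hs : n + 4 ≤ 2 ^ s) :
    n < (2 * width (Z n) + 4) ^ (2 * width (Z n)) * (s + 2) := by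
  by_contra hcon
  push Not at hcon
  obtain ⟨p, hp⟩ := exists_repairing_width_eq n
  set K := 2 * width (Z n) with hKdef
  obtain ⟨r, hr⟩ := Nat.exists_eq_add_of_le hcon
  have hself := factorAt_self n
  have hK : ∀ t, (boundaries p.toPlay.time t 0 (Z n).toList.length).card ≤ K := by
    intro t; rw [hKdef, ← hp]; exact p.card_boundaries_le t
  have hF := (FactorAt.leftmost (l := (Z n).toList) (m := (K + 4) ^ K * (s + 2)) r (a := 0)
    (by rw [← hr]; exact hself)).1
  obtain ⟨t, ht⟩ := exists_boundaries p.toPlay hK (s := s) (fun q hq => by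
    have h1 := height_Z_le n q hq
    have h2 : ((n : ℤ) + 4) ≤ 2 ^ s := by exact_mod_cast hs
    linarith) K _ hF
  have h1 := Finset.card_le_card (boundaries_subset (τ := p.toPlay.time) (t := t)
    (Nat.zero_le (0 + r)) hF.add_length_le)
  have h2 := hK t
  omega

theorem add_four_le_two_pow {r : ℕ} (hr : 10 ≤ r) : (r + 1) ^ 2 + 4 ≤ 2 ^ (r - 2) := by
  induction r, hr using Nat.le_induction with
  | base => norm_num
  | succ r hr ih =>
    rw [show r + 1 - 2 = r - 2 + 1 by omega, pow_succ 2]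
    nlinarith

theorem lt_width_pow {n : ℕ} (hn : 100 ≤ n) :
    n < ((2 * width (Z n) + 4) ^ (2 * width (Z n))) ^ 2 := by
  have h1 : n < (n.sqrt + 1) ^ 2 := Nat.lt_succ_sqrt' n
  have h2 : n.sqrt ^ 2 ≤ n := Nat.sqrt_le' n
  have h3 : 10 ≤ n.sqrt := Nat.le_sqrt.2 (by omega)
  -- A choice of `s` near `log n` would be sharper, but `s + 2 = n.sqrt` cancels neatly and costs
  -- only a square, a factor 2 after taking logarithms.
  have h4 := lt_of_width (n := n) (s := n.sqrt - 2) (by have := add_four_le_two_pow h3; omega)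
  rw [show n.sqrt - 2 + 2 = n.sqrt by omega] at h4
  have h5 : n.sqrt < (2 * width (Z n) + 4) ^ (2 * width (Z n)) := by
    by_contra h6
    push Not at h6
    have := Nat.mul_le_mul_right n.sqrt h6
    rw [← pow_two] at this
    omega
  exact h1.trans_le (Nat.pow_le_pow_left h5 2)

theorem log_le_width_mul {n : ℕ} (hn : 100 ≤ n) :
    Real.log n ≤ 4 * width (Z n) * Real.log (2 * width (Z n) + 4) := by
  have h1 : (n : ℝ) ≤ ((2 * width (Z n) + 4) ^ (2 * width (Z n))) ^ 2 := by
    exact_mod_cast (lt_width_pow hn).le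
  have h2 := Real.log_le_log (by positivity) h1
  rw [Real.log_pow, Real.log_pow] at h2
  push_cast at h2
  linarith

theorem isBigO_log_div_loglog_width :
    (fun n : ℕ => Real.log n / Real.log (Real.log n))
      =O[atTop] fun n : ℕ => (width (Z n) : ℝ) := by
  have hlog : Tendsto (fun n : ℕ => Real.log n) atTop atTop :=
    Real.tendsto_log_atTop.comp tendsto_natCast_atTop_atTop
  refine IsBigO.of_bound 8 ?_
  filter_upwards [eventually_ge_atTop 100, hlog.eventually_ge_atTop 4] with n hn hL
  set x := Real.log n
  set W : ℝ := (width (Z n) : ℝ)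
  have hW0 : 0 ≤ W := Nat.cast_nonneg _
  have hx : 1 ≤ Real.log x := by
    rw [Real.le_log_iff_exp_le (by linarith)]
    linarith [Real.exp_one_lt_d9]
  have hmain : x ≤ 4 * W * Real.log (2 * W + 4) := log_le_width_mul hn
  rw [Real.norm_of_nonneg (by positivity), Real.norm_of_nonneg hW0, div_le_iff₀ (by linarith)]
  -- If `W` is at least `x = log n` the bound is immediate; otherwise `2 * W + 4 ≤ x ^ 2`, which
  -- turns the logarithm of the width into `2 * log x`.
  rcases le_total x W with h | h
  · nlinarith
  · have h1 : Real.log (2 * W + 4) ≤ 2 * Real.log x := by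
      have : Real.log (2 * W + 4) ≤ Real.log (x ^ 2) :=
        Real.log_le_log (by linarith) (by nlinarith)
      simpa [Real.log_pow] using this
    nlinarith

/-- The length is `2 ^ (n + 1) - 2`, so its logarithm lies between `n / 2` and `n`, and `n / 2 ≥ √n`
for `n ≥ 4`. -/
theorem loglog_length_Z {n : ℕ} (hn : 4 ≤ n) :
    Real.log n ≤ 2 * Real.log (Real.log ((Z n).toList.length : ℝ)) ∧
    Real.log (Real.log ((Z n).toList.length : ℝ)) ≤ Real.log n := by
  have h0 := length_Z_add_two n
  have hn' : (4 : ℝ) ≤ n := by exact_mod_cast hn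
  have h1 : (2 : ℝ) ^ n ≤ (Z n).toList.length := by
    have : 2 ≤ 2 ^ n := Nat.le_self_pow (by omega) 2
    rw [pow_succ] at h0
    exact_mod_cast (by omega : 2 ^ n ≤ (Z n).toList.length)
  have h2 : ((Z n).toList.length : ℝ) ≤ 2 ^ (n + 1) := by
    exact_mod_cast (by omega : (Z n).toList.length ≤ 2 ^ (n + 1))
  have hpos : (0 : ℝ) < 2 ^ n := by positivity
  have h3 := Real.log_le_log hpos h1
  have h4 := Real.log_le_log (hpos.trans_le h1) h2
  rw [Real.log_pow] at h3 h4
  have h5 := Real.log_two_gt_d9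
  have h6 := Real.log_two_lt_d9
  set y := Real.log ((Z n).toList.length : ℝ)
  push_cast at h4
  have h7 : (n : ℝ) / 2 ≤ y := by nlinarith
  have h8 : y ≤ n := by nlinarith
  refine ⟨?_, Real.log_le_log (by linarith) h8⟩
  have h9 := Real.log_le_log (by linarith : (0 : ℝ) < n) (by nlinarith : (n : ℝ) ≤ y ^ 2)
  simpa [Real.log_pow] using h9

theorem div_log_bounds {x y : ℝ} (hx : 4 ≤ x) (h1 : x ≤ 2 * y) (h2 : y ≤ x) :
    ‖x / Real.log x‖ ≤ 2 * ‖y / Real.log y‖ ∧ ‖y / Real.log y‖ ≤ 2 * ‖x / Real.log x‖ := by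
  have hly : 0 < Real.log y := Real.log_pos (by linarith)
  have hlyx : Real.log y ≤ Real.log x := Real.log_le_log (by linarith) h2
  have hlx : Real.log x ≤ 2 * Real.log y := by
    have := Real.log_le_log (by linarith : 0 < x) (by nlinarith : x ≤ y ^ 2)
    simpa [Real.log_pow] using this
  have hx0 : 0 < x := by linarith
  have hy0 : 0 < y := by linarith
  have hlx0 : 0 < Real.log x := hly.trans_le hlyx
  rw [Real.norm_of_nonneg (by positivity), Real.norm_of_nonneg (by positivity),
    ← mul_div_assoc, ← mul_div_assoc]
  refine ⟨div_le_div₀ (by positivity) h1 hly hlyx, ?_⟩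
  rw [div_le_div_iff₀ hly hlx0]
  nlinarith

theorem isTheta_log_div_loglog :
    (fun n : ℕ => Real.log n / Real.log (Real.log n))
      =Θ[atTop] fun n : ℕ => Real.log (Real.log ((Z n).toList.length : ℝ)) /
        Real.log (Real.log (Real.log ((Z n).toList.length : ℝ))) := by
  have hlog : Tendsto (fun n : ℕ => Real.log n) atTop atTop :=
    Real.tendsto_log_atTop.comp tendsto_natCast_atTop_atTop
  constructor <;> refine IsBigO.of_bound 2 ?_ <;>
    filter_upwards [eventually_ge_atTop 4, hlog.eventually_ge_atTop 4] with n hn hL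
  · exact (div_log_bounds hL (loglog_length_Z hn).1 (loglog_length_Z hn).2).1
  · exact (div_log_bounds hL (loglog_length_Z hn).1 (loglog_length_Z hn).2).2

end RePairing

theorem mainTheorem4 :
    ((fun n : ℕ => Real.log n / Real.log (Real.log n))
      =O[atTop] fun n : ℕ => (RePairing.width (RePairing.Z n) : ℝ)) ∧
    ((fun n : ℕ => Real.log (Real.log ((RePairing.Z n).toList.length : ℝ)) /
        Real.log (Real.log (Real.log ((RePairing.Z n).toList.length : ℝ))))
      =O[atTop] fun n : ℕ => (RePairing.width (RePairing.Z n) : ℝ)) ∧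
    ((fun n : ℕ => Real.log n / Real.log (Real.log n))
      =Θ[atTop] fun n : ℕ => Real.log (Real.log ((RePairing.Z n).toList.length : ℝ)) /
        Real.log (Real.log (Real.log ((RePairing.Z n).toList.length : ℝ)))) :=
  ⟨RePairing.isBigO_log_div_loglog_width,
    RePairing.isTheta_log_div_loglog.2.trans RePairing.isBigO_log_div_loglog_width,
    RePairing.isTheta_log_div_loglog⟩
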